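/- Let $n,m,k,q,M,N$ be non-negative integers with $q,N>0$, let $\mathcal X\subseteq\mathbb R^n$ and $\mathbf x\in\mathcal X$, and write $\underline{\mathcal U}=\{1\}\times\mathbb R^m$. Let $\underline{\mathbf k}(\mathbf x)\in\mathbb R^{m+1}$ be a baseline control, let $\mathbf C\in\mathbb R^{q\times k}$ and $\mathbf d\in\mathbb R^q$ be such that $\Xi=\{\boldsymbol\xi\in\mathbb R^k\mid \mathbf C\boldsymbol\xi\le\mathbf d\}$ is compact, and equip $\Xi$ with the metric $d(\boldsymbol\xi,\boldsymbol\xi')=\|\boldsymbol\xi-\boldsymbol\xi'\|_1$. Let $\boldsymbol\xi_1,\dots,\boldsymbol\xi_N\in\Xi$ be samples, $r\ge 0$ and $\epsilon\in(0,1)$. Let $\mathcal M_N^r$ be the set of Borel probability measures on $\Xi$ with finite first moment whose 1-Wasserstein distance to the empirical distribution $\frac1N\sum_{i=1}^N\delta_{\boldsymbol\xi_i}$ is at most $r$. For $l\in[M]=\{1,\dots,M\}$ let $$G_l(\mathbf x,\underline{\mathbf u},\boldsymbol\xi)=\underline{\mathbf u}^\top\mathbf q_l(\mathbf x)+\underline{\mathbf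 u}^\top\mathbf R_l(\mathbf x)\boldsymbol\xi+\alpha_l(J_l(\mathbf x)),$$ where $\mathbf q_l(\mathbf x)\in\mathbb R^{m+1}$, $\mathbf R_l(\mathbf x)\in\mathbb R^{(m+1)\times k}$, $J_l:\mathcal X\to\mathbb R$ and $\alpha_l:\mathbb R\to\mathbb R$. Consider the worst-case CVaR control synthesis problem $$\min_{\underline{\mathbf u}\in\underline{\mathcal U}}\ \|\underline{\mathbf u}-\underline{\mathbf k}(\mathbf x)\|^2\quad\text{s.t.}\quad \sup_{\mathbb P\in\mathcal M_N^r}\ \inf_{t\in\mathbb R}\Big[\epsilon^{-1}\,\mathbb E_{\mathbb P}\big[(G_l(\mathbf x,\underline{\mathbf u},\boldsymbol\xi)+t)_+\big]-t\Big]\le 0\quad\forall l\in[M].\qquad (1)$$ Then the following problem, in the variables $\underline{\mathbf u}\in\underline{\mathcal U}$ and, for $l\in[M]$ and $i\in[N]$, $t_l\in\mathbb R$, $s_l(i)\in\mathbb R$, $\beta_l\in\mathbb R_{\ge0}$, $\boldsymbol\eta_{l,i}\in\mathbb R^q$, is a convex quadratic program (finitely many affine constraints, convex quadratic objective) and is equivalent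 to (1): $$\begin{aligned}\min\ \ &\|\underline{\mathbf u}-\underline{\mathbf k}(\mathbf x)\|^2\\ \text{s.t.}\ \ &\beta_l r+\tfrac1N\textstyle\sum_{i=1}^N s_l(i)-t_l\epsilon\le0,\qquad s_l(i)\ge0,\\ &s_l(i)\ge\underline{\mathbf u}^\top\mathbf q_l(\mathbf x)+t_l+(\underline{\mathbf u}^\top\mathbf R_l(\mathbf x)-\boldsymbol\eta_{l,i}^\top\mathbf C)\boldsymbol\xi_i+\boldsymbol\eta_{l,i}^\top\mathbf d+\alpha_l(J_l(\mathbf x)),\\ &|\mathbf R_l(\mathbf x)^\top\underline{\mathbf u}-\mathbf C^\top\boldsymbol\eta_{l,i}|\le\beta_l\mathbf 1_k\ \text{(entrywise)},\qquad \boldsymbol\eta_{l,i}\ge\mathbf 0_q,\qquad\forall i\in[N],\ l\in[M].\end{aligned}\qquad (2)$$ Equivalent means: $\underline{\mathbf u}$ is feasible for (1) if and only if it extends to a feasible point of (2), with the same objective value; the two optimal values coincide ($+\infty$ if infeasible); and $\underline{\mathbf u}$ is optimal for (1) if and only if it extends to an optimal point of (2). -/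

import Mathlib

open MeasureTheory Matrix
open scoped ENNReal

noncomputable section

namespace DRControl

/-! ### Optimization problems -/

/-- A minimization problem `min objective z` subject to `z ∈ feasible`. -/
structure OptProblem (E : Type*) where
  /-- the feasible set -/
  feasible : Set E
  /-- the objective function -/
  objective : E → ℝ

/-- `z` is an optimal solution (a global minimizer over the feasible set). -/
def OptProblem.IsOptimal {E : Type*} (P : OptProblem E) (z : E) : Prop :=
  z ∈ P.feasible ∧ ∀ z' ∈ P.feasible, P.objective z ≤ P.objective z'

/-- The optimal value; it is `⊤` if the problem is infeasible. -/
def OptProblem.value {E : Type*} (P : OptProblem E) : EReal :=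
  ⨅ z ∈ P.feasible, (P.objective z : EReal)

/-- `P` is a (convex) quadratic program: the decision space is a finite-dimensional real vector
space, the feasible set is cut out by finitely many affine inequalities (an equality being two
inequalities), and the objective is a quadratic polynomial with positive semidefinite
quadratic part. -/
def OptProblem.IsQP {E : Type*} [AddCommGroup E] [Module ℝ E] (P : OptProblem E) : Prop :=
  FiniteDimensional ℝ E ∧
  (∃ (K : ℕ) (a : Fin K → E →ₗ[ℝ] ℝ) (b : Fin K → ℝ),
    P.feasible = {z | ∀ j, a j z ≤ b j}) ∧
  (∃ (B : E →ₗ[ℝ] E →ₗ[ℝ] ℝ) (c : E →ₗ[ℝ] ℝ) (e : ℝ),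
    (∀ z w, B z w = B w z) ∧ (∀ z, 0 ≤ B z z) ∧ ∀ z, P.objective z = B z z + c z + e)

/-- Equivalence of a problem in the variable `u` with a problem in the variables `(u, w)`, where
`w` collects auxiliary variables: both have the same objective, `u` is feasible for the first
iff it extends to a feasible point of the second, both have the same optimal value, and `u` is
optimal for the first iff it extends to an optimal point of the second. -/
def OptProblem.EquivalentLift {E F : Type*} (P : OptProblem E) (Q : OptProblem (E × F)) : Prop :=
  (∀ u w, Q.objective (u, w) = P.objective u) ∧
  (∀ u, u ∈ P.feasible ↔ ∃ w, (u, w) ∈ Q.feasible) ∧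
  P.value = Q.value ∧
  (∀ u, P.IsOptimal u ↔ ∃ w, Q.IsOptimal (u, w))

/-! ### Wasserstein ambiguity sets and conditional value-at-risk -/

section Wasserstein

variable {X : Type*} [PseudoEMetricSpace X] [MeasurableSpace X]

/-- Measures on `X × X` with marginals `μ` and `ν`. -/
def couplings (μ ν : Measure X) : Set (Measure (X × X)) :=
  {γ | γ.map Prod.fst = μ ∧ γ.map Prod.snd = ν}

/-- The `p`-Wasserstein distance with respect to the metric of `X`. -/
def wasserstein (p : ℝ) (μ ν : Measure X) : ℝ≥0∞ :=
  (⨅ γ ∈ couplings μ ν, ∫⁻ z, edist z.1 z.2 ^ p ∂γ) ^ (1 / p)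

/-- Probability measures on `X` with finite `p`-th moment. -/
def finiteMoment (X : Type*) [PseudoEMetricSpace X] [MeasurableSpace X] (p : ℝ) :
    Set (ProbabilityMeasure X) :=
  {μ | ∃ x₀ : X, ∫⁻ x, edist x x₀ ^ p ∂(μ : Measure X) < ∞}

/-- The empirical distribution `(1/N) ∑ i, δ_{ξ i}`. -/
def empirical {N : ℕ} (ξ : Fin N → X) : Measure X :=
  (N : ℝ≥0∞)⁻¹ • ∑ i, Measure.dirac (ξ i)

/-- The Wasserstein ball of radius `r` around the empirical distribution. -/
def ambiguitySet (p r : ℝ) {N : ℕ} (ξ : Fin N → X) : Set (ProbabilityMeasure X) :=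
  {μ | μ ∈ finiteMoment X p ∧ wasserstein p (μ : Measure X) (empirical ξ) ≤ ENNReal.ofReal r}

end Wasserstein

/-- Conditional value-at-risk of `Q` at level `1 - ε`:
`inf_t (ε⁻¹ E[(Q + t)₊] - t)`. The infimum is taken in the extended reals. -/
def CVaR {Ω : Type*} [MeasurableSpace Ω] (ε : ℝ) (μ : Measure Ω) (Q : Ω → ℝ) : EReal :=
  ⨅ t : ℝ, ((ε⁻¹ * ∫ ω, max (Q ω + t) 0 ∂μ - t : ℝ) : EReal)

/-! ### The control synthesis problem -/

/-- The polyhedron `{ξ ∈ ℝᵏ | C ξ ≤ d}`, as a subset of `ℝᵏ` with the `L¹` metric. -/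
def polyhedron {k q : ℕ} (C : Matrix (Fin q) (Fin k) ℝ) (d : Fin q → ℝ) :
    Set (PiLp 1 (fun _ : Fin k => ℝ)) :=
  {ξ | C *ᵥ ξ.ofLp ≤ d}

/-- The data of a control synthesis problem: state set `𝒳 ⊆ ℝⁿ`, input dimension `m`, uncertainty
dimension `k`, baseline controller, and, for each of `M` constraints, the functions
`q_l, R_l, α_l, J_l` that define it. -/
structure SynthesisData (n m k M : ℕ) where
  /-- the state set -/
  stateSet : Set (EuclideanSpace ℝ (Fin n))
  /-- the baseline controller -/
  baseline : stateSet → EuclideanSpace ℝ (Fin (m + 1))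
  /-- the vectors `q_l(x)` -/
  q : Fin M → stateSet → Fin (m + 1) → ℝ
  /-- the matrices `R_l(x)` -/
  R : Fin M → stateSet → Matrix (Fin (m + 1)) (Fin k) ℝ
  /-- the functions `α_l` -/
  α : Fin M → ℝ → ℝ
  /-- the certificate functions `J_l` -/
  J : Fin M → stateSet → ℝ

/-- The input set `{1} × ℝᵐ`. -/
def inputSet (m : ℕ) : Set (EuclideanSpace ℝ (Fin (m + 1))) := {u | u 0 = 1}

namespace SynthesisData

variable {n m k M : ℕ} (D : SynthesisData n m k M)

/-- The constraint function
`G_l(x, u, ξ) = uᵀ q_l(x) + uᵀ R_l(x) ξ + α_l(J_l(x))`. -/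
def G (l : Fin M) (x : D.stateSet) (u : EuclideanSpace ℝ (Fin (m + 1)))
    (ξ : PiLp 1 (fun _ : Fin k => ℝ)) : ℝ :=
  u.ofLp ⬝ᵥ D.q l x + u.ofLp ⬝ᵥ (D.R l x *ᵥ ξ.ofLp) + D.α l (D.J l x)

/-- The distributionally robust problem at the state `x`, with support set `Ξ`, samples `ξ`,
1-Wasserstein radius `r` and risk tolerance `ε`: minimize `‖u - k(x)‖²` over `u ∈ {1} × ℝᵐ`
subject to `sup_{P} CVaR_{1-ε}^P (G_l(x, u, ·)) ≤ 0` for all `l`, the supremum being taken over the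
ambiguity set. -/
def robustProblem (x : D.stateSet) (Ξ : Set (PiLp 1 (fun _ : Fin k => ℝ))) {N : ℕ}
    (ξ : Fin N → Ξ) (r ε : ℝ) : OptProblem (EuclideanSpace ℝ (Fin (m + 1))) where
  feasible := {u | u ∈ inputSet m ∧ ∀ l : Fin M,
    (⨆ μ ∈ ambiguitySet 1 r ξ,
      CVaR ε (μ : Measure Ξ) (fun ζ : Ξ => D.G l x u (ζ : PiLp 1 (fun _ : Fin k => ℝ)))) ≤ 0}
  objective := fun u => ‖u - D.baseline x‖ ^ 2

end SynthesisData

/-- The auxiliary variables `(t, s, β, η)` of the quadratic program: `t l`, `s l i`, `β l` are real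
numbers and `η l i` is a vector in `ℝ^q`. -/
abbrev AuxVars (M N q : ℕ) : Type :=
  (Fin M → ℝ) × (Fin M → Fin N → ℝ) × (Fin M → ℝ) × (Fin M → Fin N → Fin q → ℝ)

/-- The quadratic program at the state `x` for the support set `{ξ | C ξ ≤ d}`. -/
def SynthesisData.quadraticProblem {n m k M : ℕ} (D : SynthesisData n m k M) (x : D.stateSet)
    {q : ℕ} (C : Matrix (Fin q) (Fin k) ℝ) (d : Fin q → ℝ) {N : ℕ}
    (ξ : Fin N → polyhedron C d) (r ε : ℝ) :
    OptProblem (EuclideanSpace ℝ (Fin (m + 1)) × AuxVars M N q) where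
  feasible := {z | match z with
    | (u, t, s, β, η) =>
      u ∈ inputSet m ∧ ∀ l : Fin M,
        0 ≤ β l ∧
        β l * r + (1 / (N : ℝ)) * ∑ i, s l i - t l * ε ≤ 0 ∧
        ∀ i : Fin N,
          0 ≤ s l i ∧
          u.ofLp ⬝ᵥ D.q l x + t l
            + (u.ofLp ᵥ* D.R l x - η l i ᵥ* C) ⬝ᵥ (ξ i : PiLp 1 (fun _ : Fin k => ℝ)).ofLp
            + η l i ⬝ᵥ d + D.α l (D.J l x) ≤ s l i ∧
          (∀ j : Fin k, |((D.R l x)ᵀ *ᵥ u.ofLp - Cᵀ *ᵥ η l i) j| ≤ β l) ∧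
          0 ≤ η l i}
  objective := fun z => ‖z.1 - D.baseline x‖ ^ 2

end DRControl

end

/-! For fixed `u` each `G_l` is an affine function `A ⬝ᵥ ζ + b` of the uncertainty, and the
constraints of the quadratic program split over `l` into copies of the linear system
`IsDualFeasible`. Everything rests on `iSup_CVaR_nonpos_iff`: the worst-case CVaR is nonpositive iff
this system is solvable.

If it is solvable, `max (A ⬝ᵥ ζ + b + t) 0 ≤ s i + β * dist ζ (ξ i)` on the polyhedron. Integrating
against couplings with the empirical measure (`lintegral_le_of_wasserstein_le`) bounds the
expectation over the whole Wasserstein ball, and the single value `t` bounds every CVaR.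

If it is not solvable, Farkas' lemma gives multipliers that read as a transport plan: mass `p i ≤ 1
/ N` of total `ε` leaves `ξ i` with mass-weighted displacement `w i`, at cost at most `r`, with
positive gain (`exists_transport_of_not_isDualFeasible`). The moved empirical measure lies in the
ball, and one lower bound `ε⁻¹ * g > 0` holds for all `t` at once, so its CVaR is positive. No
minimax theorem is needed, since one measure defeats every `t`. -/

/-! ### Farkas' lemma -/

/-- **Farkas' lemma**, homogeneous form: a linear functional that is nonpositive on the cone cut out
by finitely many functionals is a nonnegative combination of them. -/
theorem exists_nonneg_combination_of_forall_nonpos {ι E : Type*} [AddCommGroup E] [Module ℝ E]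
    (s : Finset ι) (a : ι → E →ₗ[ℝ] ℝ) (c : E →ₗ[ℝ] ℝ)
    (h : ∀ x, (∀ j ∈ s, a j x ≤ 0) → c x ≤ 0) :
    ∃ y : ι → ℝ, (∀ j, 0 ≤ y j) ∧ c = ∑ j ∈ s, y j • a j := by
  classical
  induction s using Finset.induction_on generalizing a c with
  | empty =>
    refine ⟨0, fun _ => le_rfl, ?_⟩
    ext x
    have h₁ := h x (by simp)
    have h₂ := h (-x) (by simp)
    simp only [map_neg, Left.neg_nonpos_iff] at h₂
    simpa using le_antisymm h₁ h₂
  | insert i s his ih =>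
    by_cases hc : ∀ x, (∀ j ∈ s, a j x ≤ 0) → c x ≤ 0
    · obtain ⟨y, hy, hcy⟩ := ih a c hc
      refine ⟨fun j => if j = i then 0 else y j, fun j => ?_, ?_⟩
      · by_cases hj : j = i <;> simp [hj, hy j]
      · rw [Finset.sum_insert his, hcy]
        simp only [if_true, zero_smul, zero_add]
        refine Finset.sum_congr rfl fun j hj => ?_
        rw [if_neg (ne_of_mem_of_not_mem hj his)]
    -- The new functional is genuinely needed: some point of the smaller cone has `c > 0`, so `a i`
    -- must be positive there. Scaled to `a i x₀ = 1`, it projects along `x₀` onto the kernel of `a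
    -- i`, where the induction hypothesis applies.
    · push Not at hc
      obtain ⟨x₁, hx₁, hcx₁⟩ := hc
      have hi : 0 < a i x₁ := by
        by_contra! hle
        refine absurd (h x₁ fun j hj => ?_) (not_le.2 hcx₁)
        rcases Finset.mem_insert.1 hj with rfl | hj
        · exact hle
        · exact hx₁ j hj
      obtain ⟨x₀, hx₀, hcx₀, hix₀⟩ :
          ∃ x₀, (∀ j ∈ s, a j x₀ ≤ 0) ∧ 0 < c x₀ ∧ a i x₀ = 1 := by
        refine ⟨(a i x₁)⁻¹ • x₁, fun j hj => ?_, ?_, ?_⟩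
        · simpa using mul_nonpos_of_nonneg_of_nonpos (inv_nonneg.2 hi.le) (hx₁ j hj)
        · simpa using mul_pos (inv_pos.2 hi) hcx₁
        · simpa using inv_mul_cancel₀ hi.ne'
      obtain ⟨y, hy, hcy⟩ := ih (fun j => a j - a j x₀ • a i) (c - c x₀ • a i) fun x hx => by
        have := h (x - a i x • x₀) fun j hj => by
          rcases Finset.mem_insert.1 hj with rfl | hj
          · simp [hix₀]
          · simpa [mul_comm] using hx j hj
        simpa [mul_comm] using this
      -- The coefficient of `a i` collects the terms introduced by the projection; it is nonnegative
      -- because `c x₀ > 0` and `a j x₀ ≤ 0`.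
      refine ⟨fun j => if j = i then c x₀ - ∑ j ∈ s, y j * a j x₀ else y j, fun j => ?_, ?_⟩
      · by_cases hj : j = i
        · simp only [hj, if_true]
          have : ∑ j ∈ s, y j * a j x₀ ≤ 0 :=
            Finset.sum_nonpos fun j hj => mul_nonpos_of_nonneg_of_nonpos (hy j) (hx₀ j hj)
          linarith
        · simp [hj, hy j]
      · have hs : ∑ j ∈ s, (if j = i then c x₀ - ∑ j ∈ s, y j * a j x₀ else y j) • a j
            = ∑ j ∈ s, y j • a j :=
          Finset.sum_congr rfl fun j hj => by rw [if_neg (ne_of_mem_of_not_mem hj his)]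
        rw [Finset.sum_insert his, hs]
        ext x
        have hx := LinearMap.congr_fun hcy x
        simp only [LinearMap.sub_apply, LinearMap.smul_apply, LinearMap.sum_apply, smul_eq_mul,
          mul_sub, Finset.sum_sub_distrib, ← mul_assoc, ← Finset.sum_mul] at hx
        simp only [LinearMap.add_apply, LinearMap.smul_apply, LinearMap.sum_apply, smul_eq_mul,
          if_true, sub_mul]
        linarith

/-- **Farkas' lemma**, inhomogeneous form: an infeasible finite system of affine inequalities has
a certificate of infeasibility. -/
theorem exists_infeasibility_certificate {ι E : Type*} [Fintype ι] [AddCommGroup E] [Module ℝ E]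
    (a : ι → E →ₗ[ℝ] ℝ) (b : ι → ℝ) (h : ¬∃ x, ∀ j, a j x ≤ b j) :
    ∃ y : ι → ℝ, (∀ j, 0 ≤ y j) ∧ (∀ x, ∑ j, y j * a j x = 0) ∧ ∑ j, y j * b j < 0 := by
  -- Homogenize with an extra coordinate `τ`: a solution of `a j x ≤ b j * τ` with `τ > 0` would
  -- rescale to a solution of the original system, so `τ ≤ 0` on the cone. Evaluating the
  -- combination at `(0, 1)` gives `∑ y j * b j = -1`.
  obtain ⟨y, hy, he⟩ := exists_nonneg_combination_of_forall_nonpos Finset.univ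
    (fun j => a j ∘ₗ LinearMap.fst ℝ E ℝ - b j • LinearMap.snd ℝ E ℝ) (LinearMap.snd ℝ E ℝ)
    fun z hz => by
      by_contra! hpos
      refine h ⟨z.2⁻¹ • z.1, fun j => ?_⟩
      have := hz j (Finset.mem_univ j)
      simp only [LinearMap.sub_apply, LinearMap.comp_apply, LinearMap.fst_apply,
        LinearMap.smul_apply, LinearMap.snd_apply, smul_eq_mul] at this hpos
      rw [map_smul, smul_eq_mul, inv_mul_le_iff₀ hpos]
      linarith
  refine ⟨y, hy, fun x => ?_, ?_⟩
  · have := LinearMap.congr_fun he (x, 0)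
    simpa using this.symm
  · have := LinearMap.congr_fun he (0, 1)
    simp only [LinearMap.snd_apply, LinearMap.sum_apply, LinearMap.smul_apply,
      LinearMap.sub_apply, LinearMap.comp_apply, LinearMap.fst_apply, map_zero, smul_eq_mul,
      mul_one, zero_sub, mul_neg, Finset.sum_neg_distrib] at this
    linarith

/-! ### Polyhedral sets -/

/-- Real-valued affine functions on a vector space. -/
def IsAffineFun {E : Type*} [AddCommGroup E] [Module ℝ E] (f : E → ℝ) : Prop :=
  ∃ (a : E →ₗ[ℝ] ℝ) (c : ℝ), ∀ z, f z = a z + c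

/-- Sets cut out by finitely many affine inequalities. -/
def IsPolyhedral {E : Type*} [AddCommGroup E] [Module ℝ E] (S : Set E) : Prop :=
  ∃ (K : ℕ) (a : Fin K → E →ₗ[ℝ] ℝ) (b : Fin K → ℝ), S = {z | ∀ j, a j z ≤ b j}

section Polyhedral

variable {E : Type*} [AddCommGroup E] [Module ℝ E] {f g : E → ℝ}

theorem IsAffineFun.const (c : ℝ) : IsAffineFun fun _ : E => c :=
  ⟨0, c, by simp⟩

theorem IsLinearMap.isAffineFun (hf : IsLinearMap ℝ f) : IsAffineFun f :=
  ⟨hf.mk' f, 0, by simp⟩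

theorem IsAffineFun.add (hf : IsAffineFun f) (hg : IsAffineFun g) :
    IsAffineFun fun z => f z + g z := by
  obtain ⟨a, c, ha⟩ := hf
  obtain ⟨a', c', ha'⟩ := hg
  exact ⟨a + a', c + c', fun z => by simp only [ha, ha', LinearMap.add_apply]; ring⟩

theorem IsAffineFun.const_mul (hf : IsAffineFun f) (r : ℝ) : IsAffineFun fun z => r * f z := by
  obtain ⟨a, c, ha⟩ := hf
  exact ⟨r • a, r * c, fun z => by simp only [ha, LinearMap.smul_apply, smul_eq_mul]; ring⟩

theorem IsAffineFun.mul_const (hf : IsAffineFun f) (r : ℝ) : IsAffineFun fun z => f z * r := by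
  simpa only [mul_comm _ r] using hf.const_mul r

theorem IsAffineFun.neg (hf : IsAffineFun f) : IsAffineFun fun z => -f z := by
  simpa using hf.const_mul (-1)

theorem IsAffineFun.sub (hf : IsAffineFun f) (hg : IsAffineFun g) :
    IsAffineFun fun z => f z - g z := by
  simpa only [sub_eq_add_neg] using hf.add hg.neg

theorem IsAffineFun.sum {ι : Type*} [Fintype ι] {f : ι → E → ℝ} (hf : ∀ i, IsAffineFun (f i)) :
    IsAffineFun fun z => ∑ i, f i z := by
  choose a c ha using hf
  exact ⟨∑ i, a i, ∑ i, c i, fun z => by simp [ha, Finset.sum_add_distrib]⟩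

theorem IsAffineFun.dotProduct_const {ι : Type*} [Fintype ι] {f : E → ι → ℝ}
    (hf : ∀ i, IsAffineFun fun z => f z i) (v : ι → ℝ) : IsAffineFun fun z => f z ⬝ᵥ v :=
  IsAffineFun.sum fun i => (hf i).mul_const (v i)

theorem IsPolyhedral.of_finite {ι : Type*} [Finite ι] {S : Set E} (a : ι → E →ₗ[ℝ] ℝ)
    (b : ι → ℝ) (hS : ∀ z, z ∈ S ↔ ∀ j, a j z ≤ b j) : IsPolyhedral S := by
  obtain ⟨K, ⟨e⟩⟩ := Finite.exists_equiv_fin ι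
  refine ⟨K, a ∘ e.symm, b ∘ e.symm, Set.ext fun z => (hS z).trans ?_⟩
  exact e.forall_congr_left

theorem IsAffineFun.isPolyhedral_le (hf : IsAffineFun f) (hg : IsAffineFun g) :
    IsPolyhedral {z | f z ≤ g z} := by
  obtain ⟨a, c, ha⟩ := hf.sub hg
  refine .of_finite (ι := Unit) (fun _ => a) (fun _ => -c) fun z => ?_
  have := ha z
  simp only [Set.mem_ofPred_eq, forall_const]
  constructor <;> intro h <;> linarith

theorem IsPolyhedral.forall {ι : Type*} [Finite ι] {p : ι → E → Prop}
    (h : ∀ i, IsPolyhedral {z | p i z}) : IsPolyhedral {z | ∀ i, p i z} := by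
  choose K a b hab using h
  refine .of_finite (ι := Σ i, Fin (K i)) (fun j => a j.1 j.2) (fun j => b j.1 j.2) fun z => ?_
  simp only [Set.ext_iff, Set.mem_ofPred_eq] at hab
  simp [hab, Sigma.forall]

theorem IsPolyhedral.and {p p' : E → Prop} (h : IsPolyhedral {z | p z})
    (h' : IsPolyhedral {z | p' z}) : IsPolyhedral {z | p z ∧ p' z} := by
  have := IsPolyhedral.forall (ι := Bool) (p := fun b z => bif b then p z else p' z)
    (by simpa using ⟨h', h⟩)
  simpa [and_comm] using this

theorem IsAffineFun.isPolyhedral_eq (hf : IsAffineFun f) (hg : IsAffineFun g) :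
    IsPolyhedral {z | f z = g z} := by
  simpa only [le_antisymm_iff] using (hf.isPolyhedral_le hg).and (hg.isPolyhedral_le hf)

theorem IsAffineFun.isPolyhedral_abs_le (hf : IsAffineFun f) (hg : IsAffineFun g) :
    IsPolyhedral {z | |f z| ≤ g z} := by
  simpa only [abs_le'] using (hf.isPolyhedral_le hg).and (hf.neg.isPolyhedral_le hg)

end Polyhedral

/-! ### The linear program of a single constraint -/

/-- Feasibility of `(t, s, β, η)` in the linear program dual to the worst-case expectation of
`max (A ⬝ᵥ ζ + b + t) 0`. -/
def IsDualFeasible {k q N : ℕ} (A : Fin k → ℝ) (b : ℝ) (C : Matrix (Fin q) (Fin k) ℝ)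
    (d : Fin q → ℝ) (ξ : Fin N → Fin k → ℝ) (r ε t : ℝ) (s : Fin N → ℝ) (β : ℝ)
    (η : Fin N → Fin q → ℝ) : Prop :=
  0 ≤ β ∧ β * r + (1 / (N : ℝ)) * ∑ i, s i - t * ε ≤ 0 ∧
    ∀ i, 0 ≤ s i ∧ A ⬝ᵥ ξ i + b + t + η i ⬝ᵥ (d - C *ᵥ ξ i) ≤ s i ∧
      (∀ j, |A j - (η i ᵥ* C) j| ≤ β) ∧ 0 ≤ η i

/-- If the linear program is infeasible, there are masses `p i` and displacements `w i` of the
samples with a positive gain. -/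
theorem exists_transport_of_not_isDualFeasible {k q N : ℕ} (A : Fin k → ℝ) (b : ℝ)
    (C : Matrix (Fin q) (Fin k) ℝ) (d : Fin q → ℝ) (ξ : Fin N → Fin k → ℝ) {r ε : ℝ}
    (h : ¬∃ t s β η, IsDualFeasible A b C d ξ r ε t s β η) :
    ∃ (p : Fin N → ℝ) (w : Fin N → Fin k → ℝ), (∀ i, 0 ≤ p i) ∧ (∀ i, p i ≤ 1 / N) ∧
      ∑ i, p i = ε ∧ ∑ i, ∑ j, |w i j| ≤ r ∧
      (∀ i, C *ᵥ w i ≤ p i • (d - C *ᵥ ξ i)) ∧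
      0 < ∑ i, (p i * (A ⬝ᵥ ξ i + b) + A ⬝ᵥ w i) := by
  classical
  obtain ⟨T, hT⟩ : ∃ T : ℝ × (Fin N → ℝ) × ℝ × (Fin N → Fin q → ℝ) →ₗ[ℝ] ℝ,
    ∀ t s β η, T (t, s, β, η) = t := ⟨LinearMap.fst _ _ _, fun _ _ _ _ => rfl⟩
  obtain ⟨S, hS⟩ : ∃ S : Fin N → ℝ × (Fin N → ℝ) × ℝ × (Fin N → Fin q → ℝ) →ₗ[ℝ] ℝ,
    ∀ i t s β η, S i (t, s, β, η) = s i :=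
    ⟨fun i => LinearMap.proj i ∘ₗ LinearMap.fst _ _ _ ∘ₗ LinearMap.snd _ _ _,
      fun _ _ _ _ _ => rfl⟩
  obtain ⟨L, hL⟩ : ∃ L : ℝ × (Fin N → ℝ) × ℝ × (Fin N → Fin q → ℝ) →ₗ[ℝ] ℝ,
    ∀ t s β η, L (t, s, β, η) = β :=
    ⟨LinearMap.fst _ _ _ ∘ₗ LinearMap.snd _ _ _ ∘ₗ LinearMap.snd _ _ _, fun _ _ _ _ => rfl⟩
  obtain ⟨H, hH⟩ : ∃ H : Fin N → Fin q → ℝ × (Fin N → ℝ) × ℝ × (Fin N → Fin q → ℝ) →ₗ[ℝ] ℝ,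
    ∀ i a t s β η, H i a (t, s, β, η) = η i a :=
    ⟨fun i a => LinearMap.proj a ∘ₗ LinearMap.proj i ∘ₗ LinearMap.snd _ _ _ ∘ₗ
      LinearMap.snd _ _ _ ∘ₗ LinearMap.snd _ _ _, fun _ _ _ _ _ _ => rfl⟩
  -- Rows in order: risk budget, `0 ≤ β`, `0 ≤ s`, the epigraph bound, the two halves of the
  -- absolute value, `0 ≤ η`.
  let F : (Unit ⊕ Unit) ⊕ (Fin N ⊕ Fin N) ⊕ (Fin N × Fin k ⊕ Fin N × Fin k) ⊕ (Fin N × Fin q) →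
      ℝ × (Fin N → ℝ) × ℝ × (Fin N → Fin q → ℝ) →ₗ[ℝ] ℝ :=
    Sum.elim (Sum.elim (fun _ => r • L + (1 / (N : ℝ)) • ∑ i, S i - ε • T) (fun _ => -L))
      (Sum.elim (Sum.elim (fun i => -S i)
        (fun i => T + ∑ a, (d - C *ᵥ ξ i) a • H i a - S i))
      (Sum.elim (Sum.elim (fun ij => -L - ∑ a, C a ij.2 • H ij.1 a)
        (fun ij => ∑ a, C a ij.2 • H ij.1 a - L))
      (fun ia => -H ia.1 ia.2)))
  let c : (Unit ⊕ Unit) ⊕ (Fin N ⊕ Fin N) ⊕ (Fin N × Fin k ⊕ Fin N × Fin k) ⊕ (Fin N × Fin q) →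
      ℝ :=
    Sum.elim 0 (Sum.elim (Sum.elim 0 (fun i => -(A ⬝ᵥ ξ i + b)))
      (Sum.elim (Sum.elim (fun ij => -A ij.2) (fun ij => A ij.2)) 0))
  obtain ⟨y, hy, hy0, hyc⟩ := exists_infeasibility_certificate F c (by
    rintro ⟨⟨t, s, β, η⟩, hz⟩
    simp only [Sum.forall, F, c, Prod.forall, Sum.elim_inl, Sum.elim_inr] at hz
    simp [hT, hS, hL, hH] at hz
    obtain ⟨⟨h1, h2⟩, ⟨h3, h4⟩, ⟨h5, h6⟩, h7⟩ := hz
    refine h ⟨t, s, β, η, h2, by simp; linarith, fun i => ⟨h3 i, ?_, fun j => ?_, fun a => h7 i a⟩⟩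
    · have := h4 i
      simp only [dotProduct_comm (η i)]
      simp only [dotProduct, Pi.sub_apply] at this ⊢
      linarith
    · have h5 := h5 i j
      have h6 := h6 i j
      have : (η i ᵥ* C) j = ∑ a, C a j * η i a := by simp [vecMul, dotProduct, mul_comm]
      rw [this, abs_le]
      constructor <;> linarith)
  simp only [Fintype.sum_sum_type, F, c, Sum.elim_inl, Sum.elim_inr, Fintype.sum_prod_type] at hy0 hyc
  -- `lam` prices the risk budget, `p` the epigraph rows, and `w` is the difference of the prices of
  -- the two halves of the absolute value. Testing the vanishing combination on the unit vectors of
  -- `s`, `t`, `β`, `η` yields the constraints on `p` and `w`, all scaled by `lam`.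
  set lam := y (.inl (.inl ())) with hlam
  have hlam0 : 0 ≤ lam := hy _
  let p : Fin N → ℝ := fun i => y (.inr (.inl (.inr i)))
  let w : Fin N → Fin k → ℝ := fun i j =>
    y (.inr (.inr (.inl (.inl (i, j))))) - y (.inr (.inr (.inl (.inr (i, j)))))
  have hp : ∀ i, 0 ≤ p i := fun i => hy _
  have hpN : ∀ i, p i ≤ lam * (1 / N) := by
    intro i
    have h1 := hy0 (0, Pi.single i 1, 0, 0)
    have h2 := hy (.inr (.inl (.inl i)))
    simp [hT, hS, hL, hH, Pi.single_apply] at h1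
    simp only [p]
    simp
    linarith
  have hps : ∑ i, p i = lam * ε := by
    have h1 := hy0 (1, 0, 0, 0)
    simp [hT, hS, hL, hH] at h1
    simp only [p]
    linarith
  have hw : ∑ i, ∑ j, |w i j| ≤ lam * r := by
    have h1 := hy0 (0, 0, 1, 0)
    have h2 := hy (.inl (.inr ()))
    simp [hT, hS, hL, hH] at h1
    have h3 : ∑ i, ∑ j, |w i j| ≤ ∑ i, ∑ j, (y (.inr (.inr (.inl (.inl (i, j)))))
        + y (.inr (.inr (.inl (.inr (i, j)))))) := by
      gcongr with i _ j _
      have h4 := hy (.inr (.inr (.inl (.inl (i, j)))))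
      have h5 := hy (.inr (.inr (.inl (.inr (i, j)))))
      rw [abs_le]
      constructor <;> simp only [w] <;> linarith
    simp only [Finset.sum_add_distrib] at h3
    linarith
  have hC : ∀ i, C *ᵥ w i ≤ p i • (d - C *ᵥ ξ i) := by
    intro i a
    have h1 := hy0 (0, 0, 0, Pi.single i (Pi.single a 1))
    have h2 := hy (.inr (.inr (.inr (i, a))))
    simp [hT, hS, hL, hH, Pi.single_apply, ite_apply] at h1
    have h3 : (C *ᵥ w i) a = ∑ j, y (.inr (.inr (.inl (.inl (i, j))))) * C a j
        - ∑ j, y (.inr (.inr (.inl (.inr (i, j))))) * C a j := by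
      simp only [mulVec, dotProduct, w, ← Finset.sum_sub_distrib]
      exact Finset.sum_congr rfl fun j _ => by ring
    rw [h3]
    simp only [Pi.smul_apply, Pi.sub_apply, smul_eq_mul, p]
    linarith
  have hval : 0 < ∑ i, (p i * (A ⬝ᵥ ξ i + b) + A ⬝ᵥ w i) := by
    have h1 : ∑ i, A ⬝ᵥ w i = ∑ i, ∑ j, y (.inr (.inr (.inl (.inl (i, j))))) * A j
      - ∑ i, ∑ j, y (.inr (.inr (.inl (.inr (i, j))))) * A j := by
      simp only [dotProduct, w, ← Finset.sum_sub_distrib]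
      exact Finset.sum_congr rfl fun i _ => Finset.sum_congr rfl fun j _ => by ring
    rw [Finset.sum_add_distrib, h1]
    simp at hyc
    simp only [p]
    simp [mul_add, Finset.sum_add_distrib] at hyc ⊢
    linarith
  -- With `lam = 0` there is neither mass nor displacement, hence no gain; so `lam` can be divided
  -- out.
  have hlam1 : 0 < lam := by
    refine lt_of_le_of_ne hlam0 fun h0 => ?_
    rw [← h0, zero_mul] at hps hw
    have hp0 : ∀ i, p i = 0 := fun i =>
      (Finset.sum_eq_zero_iff_of_nonneg fun i _ => hp i).1 hps i (Finset.mem_univ i)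
    have hw0 : ∀ i j, w i j = 0 := fun i j => by
      have h1 := (Finset.sum_eq_zero_iff_of_nonneg fun i _ =>
        Finset.sum_nonneg fun j _ => abs_nonneg (w i j)).1 (le_antisymm hw (by positivity)) i
        (Finset.mem_univ i)
      exact abs_eq_zero.1 ((Finset.sum_eq_zero_iff_of_nonneg fun j _ => abs_nonneg _).1 h1 j
        (Finset.mem_univ j))
    simp [hp0, dotProduct, hw0] at hval
  have hli : 0 < lam⁻¹ := inv_pos.2 hlam1
  refine ⟨lam⁻¹ • p, lam⁻¹ • w, fun i => mul_nonneg hli.le (hp i), fun i => ?_, ?_, ?_,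
    fun i => ?_, ?_⟩
  · simpa [inv_mul_le_iff₀ hlam1] using hpN i
  · simp [← Finset.mul_sum, hps, hlam1.ne']
  · simpa [abs_mul, ← Finset.mul_sum, abs_of_pos hlam1, inv_mul_le_iff₀ hlam1] using hw
  · have := smul_le_smul_of_nonneg_left (hC i) hli.le
    simpa [mulVec_smul, smul_smul] using this
  · have := mul_pos hli hval
    simpa [Finset.mul_sum, mul_add, mul_assoc] using this

/-! ### The Wasserstein ball around an empirical distribution -/

section Ambiguity

open DRControl

variable {X : Type*} [MeasurableSpace X] {N : ℕ}

/-- The distribution obtained from the empirical one by moving mass `p i` from `ξ i` to `ζ i`. -/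
noncomputable def movedEmpirical (ξ ζ : Fin N → X) (p : Fin N → ℝ) : Measure X :=
  ∑ i, (ENNReal.ofReal (p i) • Measure.dirac (ζ i)
    + ENNReal.ofReal (1 / N - p i) • Measure.dirac (ξ i))

variable {ξ ζ : Fin N → X} {p : Fin N → ℝ}

theorem ofReal_add_ofReal_inv_sub (hN : 0 < N) (hp : ∀ i, 0 ≤ p i) (hpN : ∀ i, p i ≤ 1 / N)
    (i : Fin N) :
    ENNReal.ofReal (p i) + ENNReal.ofReal (1 / N - p i) = (N : ℝ≥0∞)⁻¹ := by
  rw [← ENNReal.ofReal_add (hp i) (sub_nonneg.2 (hpN i)), add_sub_cancel, one_div,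
    ENNReal.ofReal_inv_of_pos (by exact_mod_cast hN), ENNReal.ofReal_natCast]

theorem isProbabilityMeasure_movedEmpirical (hN : 0 < N) (hp : ∀ i, 0 ≤ p i)
    (hpN : ∀ i, p i ≤ 1 / N) : IsProbabilityMeasure (movedEmpirical ξ ζ p) := by
  constructor
  simp only [movedEmpirical, Measure.finsetSum_apply, Measure.add_apply, Measure.smul_apply,
    measure_univ, smul_eq_mul, mul_one, ofReal_add_ofReal_inv_sub hN hp hpN]
  simp [ENNReal.mul_inv_cancel, hN.ne']

variable [MetricSpace X] [BorelSpace X]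

theorem lintegral_empirical_le (f : X → ℝ≥0∞) (s : Fin N → ℝ≥0∞)
    (h : ∀ i, f (ξ i) ≤ s i) : ∫⁻ x, f x ∂(empirical ξ) ≤ (N : ℝ≥0∞)⁻¹ * ∑ i, s i := by
  rw [empirical, lintegral_smul_measure, lintegral_finsetSum_measure, smul_eq_mul]
  simp only [lintegral_dirac]
  gcongr with i
  exact h i

/-- Weak duality: an upper bound on the expectation of `f` over a Wasserstein ball. -/
theorem lintegral_le_of_wasserstein_le {μ : Measure X} {r : ℝ≥0∞} (hr : r ≠ ∞)
    (hμ : wasserstein 1 μ (empirical ξ) ≤ r) {f : X → ℝ≥0∞} (hf : Measurable f)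
    (s : Fin N → ℝ≥0∞) {β : ℝ≥0∞} (hβ : β ≠ ∞)
    (h : ∀ i x, f x ≤ s i + β * edist x (ξ i)) :
    ∫⁻ x, f x ∂μ ≤ (N : ℝ≥0∞)⁻¹ * ∑ i, s i + β * r := by
  classical
  -- The infimum handles repeated samples; the value `∞` off the samples is harmless because the
  -- empirical measure does not charge those points.
  let S : X → ℝ≥0∞ := fun x => ⨅ i, if x = ξ i then s i else ∞
  have hS : Measurable S := Measurable.iInf fun i =>
    Measurable.ite (measurableSet_singleton (ξ i)) measurable_const measurable_const
  have hSi : ∀ i, S (ξ i) ≤ s i := fun i => (iInf_le _ i).trans (by simp)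
  have hfS : ∀ x x', f x ≤ S x' + β * edist x x' := by
    intro x x'
    simp only [S, ENNReal.iInf_add]
    refine le_iInf fun i => ?_
    split_ifs with hi
    · rw [hi]; exact h i x
    · simp
  simp only [wasserstein, ENNReal.rpow_one, div_one] at hμ
  have hle : ∀ γ : couplings μ (empirical ξ),
      ∫⁻ x, f x ∂μ ≤ (N : ℝ≥0∞)⁻¹ * ∑ i, s i + β * ∫⁻ z, edist z.1 z.2 ∂γ.1 := by
    rintro ⟨γ, h₁, h₂⟩
    calc ∫⁻ x, f x ∂μ = ∫⁻ z, f z.1 ∂γ := by rw [← h₁, lintegral_map hf measurable_fst]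
      _ ≤ ∫⁻ z, S z.2 + β * edist z.1 z.2 ∂γ := lintegral_mono fun z => hfS _ _
      _ = ∫⁻ x, S x ∂(empirical ξ) + β * ∫⁻ z, edist z.1 z.2 ∂γ := by
        have hS' : Measurable fun z : X × X => S z.2 := hS.comp measurable_snd
        rw [lintegral_add_left hS', lintegral_const_mul' _ _ hβ, ← h₂,
          lintegral_map hS measurable_snd]
      _ ≤ _ := by gcongr; exact lintegral_empirical_le S s hSi
  -- Needed to pull `β` out of the infimum when `β = 0`: an empty infimum is `∞`, but `0 * ∞ = 0`.
  have hne : Nonempty (couplings μ (empirical ξ)) := by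
    by_contra hne
    rw [Set.not_nonempty_iff_eq_empty'.1 hne] at hμ
    simp at hμ
    exact hr hμ
  rw [iInf_subtype'] at hμ
  calc ∫⁻ x, f x ∂μ
      ≤ ⨅ γ : couplings μ (empirical ξ),
        ((N : ℝ≥0∞)⁻¹ * ∑ i, s i + β * ∫⁻ z, edist z.1 z.2 ∂γ.1) := le_iInf hle
    _ = (N : ℝ≥0∞)⁻¹ * ∑ i, s i
        + β * ⨅ γ : couplings μ (empirical ξ), ∫⁻ z, edist z.1 z.2 ∂γ.1 := by
      rw [← ENNReal.add_iInf, ENNReal.mul_iInf' (fun h => absurd h hβ) fun _ => hne]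
    _ ≤ _ := by gcongr

theorem lintegral_movedEmpirical (f : X → ℝ≥0∞) :
    ∫⁻ x, f x ∂(movedEmpirical ξ ζ p)
      = ∑ i, (ENNReal.ofReal (p i) * f (ζ i) + ENNReal.ofReal (1 / N - p i) * f (ξ i)) := by
  simp [movedEmpirical, lintegral_finsetSum_measure, lintegral_add_measure,
    lintegral_smul_measure]

theorem le_integral_movedEmpirical (hp : ∀ i, 0 ≤ p i) (hpN : ∀ i, p i ≤ 1 / N) {f : X → ℝ}
    (hf : ∀ x, 0 ≤ f x) :
    ∑ i, p i * f (ζ i) ≤ ∫ x, f x ∂(movedEmpirical ξ ζ p) := by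
  have hi : ∀ (c : ℝ) (x : X), Integrable f (ENNReal.ofReal c • Measure.dirac x) := fun c x =>
    (integrable_dirac enorm_lt_top).smul_measure ENNReal.ofReal_ne_top
  rw [movedEmpirical, integral_finsetSum_measure fun i _ => (hi _ _).add_measure (hi _ _)]
  refine Finset.sum_le_sum fun i _ => ?_
  rw [integral_add_measure (hi _ _) (hi _ _), integral_smul_measure, integral_smul_measure,
    integral_dirac, integral_dirac, ENNReal.toReal_ofReal (hp i),
    ENNReal.toReal_ofReal (sub_nonneg.2 (hpN i)), smul_eq_mul, smul_eq_mul]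
  exact le_add_of_nonneg_right (mul_nonneg (sub_nonneg.2 (hpN i)) (hf _))

/-- Couple the moved mass at `ζ i` with `ξ i` and leave the rest on the diagonal, where it costs
nothing. -/
theorem wasserstein_movedEmpirical_le (hN : 0 < N) (hp : ∀ i, 0 ≤ p i)
    (hpN : ∀ i, p i ≤ 1 / N) :
    wasserstein 1 (movedEmpirical ξ ζ p) (empirical ξ)
      ≤ ∑ i, ENNReal.ofReal (p i) * edist (ζ i) (ξ i) := by
  let γ : Measure (X × X) := ∑ i, (ENNReal.ofReal (p i) • Measure.dirac (ζ i, ξ i)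
    + ENNReal.ofReal (1 / N - p i) • Measure.dirac (ξ i, ξ i))
  have hγ : γ ∈ couplings (movedEmpirical ξ ζ p) (empirical ξ) := by
    constructor
    · ext A hA
      have hA' : MeasurableSet (Prod.fst ⁻¹' A : Set (X × X)) := measurable_fst hA
      have hind : ∀ x : X × X, (Prod.fst ⁻¹' A).indicator (1 : X × X → ℝ≥0∞) x
        = A.indicator 1 x.1 := fun _ => rfl
      rw [Measure.map_apply measurable_fst hA]
      simp only [γ, movedEmpirical, Measure.finsetSum_apply, Measure.add_apply,
        Measure.smul_apply, Measure.dirac_apply' _ hA, Measure.dirac_apply' _ hA', hind]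
    · ext A hA
      have hA' : MeasurableSet (Prod.snd ⁻¹' A : Set (X × X)) := measurable_snd hA
      have hind : ∀ x : X × X, (Prod.snd ⁻¹' A).indicator (1 : X × X → ℝ≥0∞) x
        = A.indicator 1 x.2 := fun _ => rfl
      rw [Measure.map_apply measurable_snd hA]
      simp only [γ, empirical, Measure.finsetSum_apply, Measure.add_apply, Measure.smul_apply,
        Measure.dirac_apply' _ hA, Measure.dirac_apply' _ hA', smul_eq_mul, Finset.mul_sum,
        hind, ← add_mul, ofReal_add_ofReal_inv_sub hN hp hpN]
  simp only [wasserstein, ENNReal.rpow_one, div_one]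
  refine (iInf₂_le γ hγ).trans ?_
  have hd : ∀ (c : ℝ≥0∞) (x : X × X),
      ∫⁻ z, edist z.1 z.2 ∂(c • Measure.dirac x) = c * edist x.1 x.2 := fun c x => by
    rw [lintegral_smul_measure, lintegral_dirac, smul_eq_mul]
  simp only [γ, lintegral_finsetSum_measure, lintegral_add_measure, hd, edist_self, mul_zero,
    add_zero, le_refl]

theorem exists_ambiguitySet_coe_eq_movedEmpirical (hN : 0 < N) (hp : ∀ i, 0 ≤ p i)
    (hpN : ∀ i, p i ≤ 1 / N) {r : ℝ} (hr : ∑ i, p i * dist (ζ i) (ξ i) ≤ r) :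
    ∃ μ ∈ ambiguitySet 1 r ξ, (μ : Measure X) = movedEmpirical ξ ζ p := by
  refine ⟨⟨movedEmpirical ξ ζ p, isProbabilityMeasure_movedEmpirical hN hp hpN⟩,
    ⟨⟨ξ ⟨0, hN⟩, ?_⟩, (wasserstein_movedEmpirical_le hN hp hpN).trans ?_⟩, rfl⟩
  · simp only [ProbabilityMeasure.coe_mk, ENNReal.rpow_one, lintegral_movedEmpirical]
    exact ENNReal.sum_lt_top.2 fun i _ => ENNReal.add_lt_top.2
      ⟨ENNReal.mul_lt_top ENNReal.ofReal_lt_top (edist_lt_top _ _),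
        ENNReal.mul_lt_top ENNReal.ofReal_lt_top (edist_lt_top _ _)⟩
  · simp only [edist_dist, ← ENNReal.ofReal_mul (hp _)]
    rw [← ENNReal.ofReal_sum_of_nonneg fun i _ => mul_nonneg (hp i) dist_nonneg]
    exact ENNReal.ofReal_le_ofReal hr

end Ambiguity

/-! ### The worst-case CVaR of an affine function over a polyhedron -/

section Worst

open DRControl

variable {k q N : ℕ} {A : Fin k → ℝ} {b : ℝ} {C : Matrix (Fin q) (Fin k) ℝ} {d : Fin q → ℝ}
  {ξ : Fin N → polyhedron C d} {r ε : ℝ}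

theorem dist_polyhedron (x y : polyhedron C d) :
    dist x y = ∑ j, |x.1.ofLp j - y.1.ofLp j| := by
  rw [Subtype.dist_eq, PiLp.dist_eq_sum (by simp)]
  simp [Real.dist_eq]

/-- A bounded nonempty polyhedron has no recession direction, since the points `x + n • w` would
leave every ball. This rules out displacement without mass in the transport plan. -/
theorem eq_zero_of_mulVec_nonpos (hΞ : IsCompact (polyhedron C d)) (x : polyhedron C d)
    {w : Fin k → ℝ} (hw : C *ᵥ w ≤ 0) : w = 0 := by
  by_contra hne
  obtain ⟨j, hj⟩ := Function.ne_iff.1 hne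
  obtain ⟨B, hB⟩ := hΞ.isBounded.exists_norm_le
  have hmem : ∀ n : ℕ, WithLp.toLp 1 (x.1.ofLp + (n : ℝ) • w) ∈ polyhedron C d := fun n => by
    have h₁ : C *ᵥ x.1.ofLp ≤ d := x.2
    have h₂ : (n : ℝ) • (C *ᵥ w) ≤ 0 := smul_nonpos_of_nonneg_of_nonpos n.cast_nonneg hw
    change C *ᵥ (x.1.ofLp + (n : ℝ) • w) ≤ d
    rw [mulVec_add, mulVec_smul]
    simpa using add_le_add h₁ h₂
  obtain ⟨n, hn⟩ := exists_nat_gt ((B + |x.1.ofLp j|) / |w j|)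
  have hwj : 0 < |w j| := abs_pos.2 hj
  rw [div_lt_iff₀ hwj] at hn
  have h₁ := (PiLp.norm_apply_le _ j).trans (hB _ (hmem n))
  simp only [Pi.add_apply, Pi.smul_apply, smul_eq_mul, Real.norm_eq_abs] at h₁
  have h₂ : |(n : ℝ) * w j| ≤ |x.1.ofLp j + n * w j| + |x.1.ofLp j| := by
    simpa using abs_sub (x.1.ofLp j + n * w j) (x.1.ofLp j)
  rw [abs_mul, Nat.abs_cast] at h₂
  linarith

theorem continuous_dotProduct_polyhedron :
    Continuous fun ζ : polyhedron C d => A ⬝ᵥ ζ.1.ofLp + b := by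
  simp only [dotProduct]
  fun_prop

/-- Split `A` into `A - η i ᵥ* C` and `η i ᵥ* C`. On the displacement `ζ - ξ i`, the first part is
controlled by `ℓ¹`–`ℓ^∞` duality, the second by `η i ≥ 0` and `C ζ ≤ d`. -/
theorem IsDualFeasible.max_affine_le {t β : ℝ} {s : Fin N → ℝ} {η : Fin N → Fin q → ℝ}
    (h : IsDualFeasible A b C d (fun i => (ξ i).1.ofLp) r ε t s β η) (i : Fin N)
    (ζ : polyhedron C d) : max (A ⬝ᵥ ζ.1.ofLp + b + t) 0 ≤ s i + β * dist ζ (ξ i) := by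
  obtain ⟨hβ, -, h⟩ := h
  obtain ⟨hs, h₁, h₂, h₃⟩ := h i
  refine max_le ?_ (add_nonneg hs (mul_nonneg hβ dist_nonneg))
  have h₄ : (A - η i ᵥ* C) ⬝ᵥ (ζ.1.ofLp - (ξ i).1.ofLp) ≤ β * dist ζ (ξ i) := by
    rw [dist_polyhedron, Finset.mul_sum]
    refine Finset.sum_le_sum fun j _ => (le_abs_self _).trans ?_
    rw [abs_mul]
    exact mul_le_mul_of_nonneg_right (h₂ j) (abs_nonneg _)
  have h₅ : η i ⬝ᵥ (C *ᵥ ζ.1.ofLp) ≤ η i ⬝ᵥ d := dotProduct_le_dotProduct_of_nonneg_left ζ.2 h₃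
  simp only [sub_dotProduct, dotProduct_sub, dotProduct_mulVec] at h₁ h₄ h₅
  linarith

theorem iSup_CVaR_nonpos_of_isDualFeasible (hN : 0 < N) (hr : 0 ≤ r) (hε : 0 < ε) {t β : ℝ}
    {s : Fin N → ℝ} {η : Fin N → Fin q → ℝ}
    (h : IsDualFeasible A b C d (fun i => (ξ i).1.ofLp) r ε t s β η) :
    (⨆ μ ∈ ambiguitySet 1 r ξ, CVaR ε (μ : Measure (polyhedron C d))
      fun ζ => A ⬝ᵥ ζ.1.ofLp + b) ≤ 0 := by
  refine iSup₂_le fun μ hμ => (iInf_le _ t).trans ?_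
  have hc : Continuous fun ζ : polyhedron C d => max (A ⬝ᵥ ζ.1.ofLp + b + t) 0 :=
    (continuous_dotProduct_polyhedron.add continuous_const).max continuous_const
  have hs : ∀ i, 0 ≤ s i := fun i => (h.2.2 i).1
  have key := lintegral_le_of_wasserstein_le ENNReal.ofReal_ne_top hμ.2
    (f := fun ζ => ENNReal.ofReal (max (A ⬝ᵥ ζ.1.ofLp + b + t) 0)) hc.measurable.ennreal_ofReal
    (fun i => ENNReal.ofReal (s i)) (β := ENNReal.ofReal β) ENNReal.ofReal_ne_top fun i ζ => by
      rw [edist_dist, ← ENNReal.ofReal_mul h.1,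
        ← ENNReal.ofReal_add (hs i) (mul_nonneg h.1 dist_nonneg)]
      exact ENNReal.ofReal_le_ofReal (h.max_affine_le i ζ)
  have hsum : 0 ≤ (N : ℝ)⁻¹ * ∑ i, s i :=
    mul_nonneg (inv_nonneg.2 N.cast_nonneg) (Finset.sum_nonneg fun i _ => hs i)
  rw [← ENNReal.ofReal_sum_of_nonneg fun i _ => hs i, ← ENNReal.ofReal_natCast,
    ← ENNReal.ofReal_inv_of_pos (by exact_mod_cast hN), ← ENNReal.ofReal_mul (by positivity),
    ← ENNReal.ofReal_mul h.1, ← ENNReal.ofReal_add hsum (mul_nonneg h.1 hr)] at key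
  have hint : ∫ ζ, max (A ⬝ᵥ ζ.1.ofLp + b + t) 0 ∂(μ : Measure (polyhedron C d))
      ≤ (N : ℝ)⁻¹ * ∑ i, s i + β * r := by
    rw [integral_eq_lintegral_of_nonneg_ae (f := fun ζ : polyhedron C d =>
        max (A ⬝ᵥ ζ.1.ofLp + b + t) 0) (.of_forall fun ζ => le_max_right _ _)
      hc.measurable.aestronglyMeasurable]
    exact ENNReal.toReal_le_of_le_ofReal (add_nonneg hsum (mul_nonneg h.1 hr)) key
  have h₂ := h.2.1
  rw [one_div] at h₂
  have : ε⁻¹ * ∫ ζ, max (A ⬝ᵥ ζ.1.ofLp + b + t) 0 ∂(μ : Measure (polyhedron C d)) - t ≤ 0 := by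
    rw [sub_nonpos, inv_mul_le_iff₀ hε]
    linarith
  exact_mod_cast this

/-- A displacement of the samples with a positive gain gives a distribution of positive CVaR. -/
theorem exists_CVaR_pos_of_transport (hN : 0 < N) (hε : 0 < ε) (hΞ : IsCompact (polyhedron C d))
    {p : Fin N → ℝ} {w : Fin N → Fin k → ℝ} (hp : ∀ i, 0 ≤ p i) (hpN : ∀ i, p i ≤ 1 / N)
    (hps : ∑ i, p i = ε) (hw : ∑ i, ∑ j, |w i j| ≤ r)
    (hC : ∀ i, C *ᵥ w i ≤ p i • (d - C *ᵥ (ξ i).1.ofLp))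
    (hpos : 0 < ∑ i, (p i * (A ⬝ᵥ (ξ i).1.ofLp + b) + A ⬝ᵥ w i)) :
    ∃ μ ∈ ambiguitySet 1 r ξ, 0 < CVaR ε (μ : Measure (polyhedron C d))
      fun ζ => A ⬝ᵥ ζ.1.ofLp + b := by
  -- The target is `ξ i + w i / p i`, and `hC` says exactly that it stays in the polyhedron. If `p i
  -- = 0`, compactness forces `w i = 0`.
  have hex : ∀ i, ∃ ζ : polyhedron C d, p i • (ζ.1.ofLp - (ξ i).1.ofLp) = w i := by
    intro i
    rcases (hp i).eq_or_lt with h0 | h0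
    · refine ⟨ξ i, ?_⟩
      have hwi : w i = 0 := eq_zero_of_mulVec_nonpos hΞ (ξ i) (by simpa [← h0] using hC i)
      simp [hwi]
    · refine ⟨⟨WithLp.toLp 1 ((ξ i).1.ofLp + (p i)⁻¹ • w i), ?_⟩, ?_⟩
      · change C *ᵥ ((ξ i).1.ofLp + (p i)⁻¹ • w i) ≤ d
        have := smul_le_smul_of_nonneg_left (hC i) (inv_nonneg.2 h0.le)
        rw [smul_smul, inv_mul_cancel₀ h0.ne', one_smul] at this
        rw [mulVec_add, mulVec_smul]
        exact le_sub_iff_add_le'.1 this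
      · simp [smul_smul, h0.ne']
  choose ζ hζ using hex
  obtain ⟨μ, hμ, hμe⟩ := exists_ambiguitySet_coe_eq_movedEmpirical (ξ := ξ) (ζ := ζ) hN hp hpN
    (r := r) (by
      refine le_of_eq_of_le (Finset.sum_congr rfl fun i _ => ?_) hw
      rw [dist_polyhedron, Finset.mul_sum, ← hζ i]
      refine Finset.sum_congr rfl fun j _ => ?_
      simp [abs_mul, abs_of_nonneg (hp i)])
  refine ⟨μ, hμ, ?_⟩
  set g := ∑ i, (p i * (A ⬝ᵥ (ξ i).1.ofLp + b) + A ⬝ᵥ w i) with hg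
  have hbound : ∀ t : ℝ, ε⁻¹ * g
      ≤ ε⁻¹ * ∫ ζ, max (A ⬝ᵥ ζ.1.ofLp + b + t) 0 ∂(μ : Measure (polyhedron C d)) - t := by
    intro t
    have h₁ := le_integral_movedEmpirical (ξ := ξ) (ζ := ζ) hp hpN
      (f := fun ζ => max (A ⬝ᵥ ζ.1.ofLp + b + t) 0) fun _ => le_max_right _ _
    -- Drop the positive part on the moved mass. Its total is `ε`, so the contribution `ε * t`
    -- cancels the `- t` of the CVaR after division by `ε`.
    have h₂ : g + ε * t ≤ ∑ i, p i * max (A ⬝ᵥ (ζ i).1.ofLp + b + t) 0 := by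
      rw [← hps, Finset.sum_mul, hg, ← Finset.sum_add_distrib]
      refine Finset.sum_le_sum fun i _ => ?_
      refine le_trans (le_of_eq ?_) (mul_le_mul_of_nonneg_left (le_max_left _ _) (hp i))
      rw [← hζ i, dotProduct_smul, dotProduct_sub, smul_eq_mul]
      ring
    rw [hμe]
    have h₃ := mul_le_mul_of_nonneg_left (h₂.trans h₁) (inv_nonneg.2 hε.le)
    rw [mul_add, inv_mul_cancel_left₀ hε.ne'] at h₃
    linarith
  have h₀ : (0 : EReal) < ((ε⁻¹ * g : ℝ) : EReal) := by
    exact_mod_cast mul_pos (inv_pos.2 hε) hpos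
  exact h₀.trans_le (le_iInf fun t => EReal.coe_le_coe_iff.2 (hbound t))

theorem iSup_CVaR_nonpos_iff (hN : 0 < N) (hr : 0 ≤ r) (hε : 0 < ε)
    (hΞ : IsCompact (polyhedron C d)) :
    (⨆ μ ∈ ambiguitySet 1 r ξ, CVaR ε (μ : Measure (polyhedron C d))
      fun ζ => A ⬝ᵥ ζ.1.ofLp + b) ≤ 0 ↔
    ∃ t s β η, IsDualFeasible A b C d (fun i => (ξ i).1.ofLp) r ε t s β η := by
  refine ⟨fun h => ?_, fun ⟨t, s, β, η, h⟩ => iSup_CVaR_nonpos_of_isDualFeasible hN hr hε h⟩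
  by_contra hno
  obtain ⟨p, w, hp, hpN, hps, hw, hC, hpos⟩ := exists_transport_of_not_isDualFeasible A b C d _ hno
  obtain ⟨μ, hμ, hlt⟩ := exists_CVaR_pos_of_transport hN hε hΞ hp hpN hps hw hC hpos
  have hle := le_iSup₂ (f := fun (μ : ProbabilityMeasure (polyhedron C d))
    (_ : μ ∈ ambiguitySet 1 r ξ) => CVaR ε (μ : Measure (polyhedron C d))
      fun ζ => A ⬝ᵥ ζ.1.ofLp + b) μ hμ
  exact absurd (hle.trans h) (not_le.2 hlt)

end Worst

/-! ### The quadratic program -/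

section Program

open DRControl

/-- As the objective ignores the auxiliary variables, values and minimizers depend only on the
projection of the feasible set. -/
theorem OptProblem.equivalentLift_of_feasible {E F : Type*} {P : OptProblem E}
    {Q : OptProblem (E × F)} (hobj : ∀ u w, Q.objective (u, w) = P.objective u)
    (hfeas : ∀ u, u ∈ P.feasible ↔ ∃ w, (u, w) ∈ Q.feasible) : P.EquivalentLift Q := by
  refine ⟨hobj, hfeas, le_antisymm ?_ ?_, fun u => ⟨fun ⟨hu, h⟩ => ?_, fun ⟨w, hw, h⟩ => ?_⟩⟩
  · refine le_iInf₂ fun ⟨u, w⟩ h => ?_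
    rw [hobj]
    exact iInf₂_le u ((hfeas u).2 ⟨w, h⟩)
  · refine le_iInf₂ fun u hu => ?_
    obtain ⟨w, hw⟩ := (hfeas u).1 hu
    rw [← hobj u w]
    exact iInf₂_le (u, w) hw
  · obtain ⟨w, hw⟩ := (hfeas u).1 hu
    refine ⟨w, hw, fun ⟨u', w'⟩ h' => ?_⟩
    rw [hobj, hobj]
    exact h u' ((hfeas u').2 ⟨w', h'⟩)
  · refine ⟨(hfeas u).2 ⟨w, hw⟩, fun u' hu' => ?_⟩
    obtain ⟨w', hw'⟩ := (hfeas u').1 hu'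
    rw [← hobj u w, ← hobj u' w']
    exact h _ hw'

/-- A squared distance in some of the coordinates is a convex quadratic polynomial. -/
theorem exists_quadratic_eq_norm_sub_sq {E F : Type*} [AddCommGroup F] [Module ℝ F]
    [NormedAddCommGroup E] [InnerProductSpace ℝ E] (v : E) :
    ∃ (B : E × F →ₗ[ℝ] E × F →ₗ[ℝ] ℝ) (c : E × F →ₗ[ℝ] ℝ) (e : ℝ),
      (∀ z w, B z w = B w z) ∧ (∀ z, 0 ≤ B z z) ∧ ∀ z : E × F, ‖z.1 - v‖ ^ 2 = B z z + c z + e := by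
  refine ⟨(innerₗ E).compl₁₂ (LinearMap.fst ℝ E F) (LinearMap.fst ℝ E F),
    (-2 : ℝ) • (innerₗ E v ∘ₗ LinearMap.fst ℝ E F), ‖v‖ ^ 2, fun z w => ?_, fun z => ?_,
    fun z => ?_⟩
  · simp [real_inner_comm]
  · simp
  · rw [norm_sub_sq_real, real_inner_comm]
    simp
    ring

variable {n m k q M N : ℕ} (D : SynthesisData n m k M) (x : D.stateSet)
  (C : Matrix (Fin q) (Fin k) ℝ) (d : Fin q → ℝ) (ξ : Fin N → polyhedron C d) (r ε : ℝ)

theorem isPolyhedral_feasible_quadraticProblem :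
    IsPolyhedral (D.quadraticProblem x C d ξ r ε).feasible := by
  have hu : ∀ a, IsAffineFun fun z : EuclideanSpace ℝ (Fin (m + 1)) × AuxVars M N q =>
      z.1.ofLp a := fun a => IsLinearMap.isAffineFun ⟨fun _ _ => rfl, fun _ _ => rfl⟩
  have ht : ∀ l, IsAffineFun fun z : EuclideanSpace ℝ (Fin (m + 1)) × AuxVars M N q =>
      z.2.1 l := fun l => IsLinearMap.isAffineFun ⟨fun _ _ => rfl, fun _ _ => rfl⟩
  have hs : ∀ l i, IsAffineFun fun z : EuclideanSpace ℝ (Fin (m + 1)) × AuxVars M N q =>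
      z.2.2.1 l i := fun l i => IsLinearMap.isAffineFun ⟨fun _ _ => rfl, fun _ _ => rfl⟩
  have hβ : ∀ l, IsAffineFun fun z : EuclideanSpace ℝ (Fin (m + 1)) × AuxVars M N q =>
      z.2.2.2.1 l := fun l => IsLinearMap.isAffineFun ⟨fun _ _ => rfl, fun _ _ => rfl⟩
  have hη : ∀ l i a, IsAffineFun fun z : EuclideanSpace ℝ (Fin (m + 1)) × AuxVars M N q =>
      z.2.2.2.2 l i a := fun l i a => IsLinearMap.isAffineFun ⟨fun _ _ => rfl, fun _ _ => rfl⟩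
  have h0 : IsAffineFun fun _ : EuclideanSpace ℝ (Fin (m + 1)) × AuxVars M N q => (0 : ℝ) :=
    .const 0
  refine (IsAffineFun.isPolyhedral_eq (hu 0) (.const 1)).and (.forall fun l => ?_)
  refine (h0.isPolyhedral_le (hβ l)).and (.and ?_ (.forall fun i =>
    (h0.isPolyhedral_le (hs l i)).and (.and ?_ (.and (.forall fun j => ?_)
      (.forall fun a => h0.isPolyhedral_le (hη l i a))))))
  · exact ((((hβ l).mul_const r).add ((IsAffineFun.sum (hs l)).const_mul _)).sub
      ((ht l).mul_const ε)).isPolyhedral_le h0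
  · refine IsAffineFun.isPolyhedral_le ?_ (hs l i)
    exact (((((IsAffineFun.dotProduct_const hu _).add (ht l)).add
      (IsAffineFun.dotProduct_const (fun j => (IsAffineFun.dotProduct_const hu _).sub
        (IsAffineFun.dotProduct_const (hη l i) _)) _)).add
      (IsAffineFun.dotProduct_const (hη l i) _)).add (.const _))
  · refine IsAffineFun.isPolyhedral_abs_le ?_ (hβ l)
    simp only [mulVec_transpose]
    exact (IsAffineFun.dotProduct_const hu _).sub (IsAffineFun.dotProduct_const (hη l i) _)

theorem mem_feasible_quadraticProblem_iff (u : EuclideanSpace ℝ (Fin (m + 1)))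
    (t : Fin M → ℝ) (s : Fin M → Fin N → ℝ) (β : Fin M → ℝ) (η : Fin M → Fin N → Fin q → ℝ) :
    (u, t, s, β, η) ∈ (D.quadraticProblem x C d ξ r ε).feasible ↔
      u ∈ inputSet m ∧ ∀ l, IsDualFeasible (u.ofLp ᵥ* D.R l x)
        (u.ofLp ⬝ᵥ D.q l x + D.α l (D.J l x)) C d (fun i => (ξ i).1.ofLp) r ε (t l) (s l) (β l)
        (η l) := by
  refine and_congr_right fun _ => forall_congr' fun l => and_congr_right fun _ =>
    and_congr_right fun _ => forall_congr' fun i => and_congr_right fun _ => and_congr ?_ ?_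
  · simp only [sub_dotProduct, dotProduct_sub, dotProduct_mulVec]
    constructor <;> intro h <;> linarith
  · simp only [mulVec_transpose, Pi.sub_apply]

theorem mem_feasible_robustProblem_iff (hN : 0 < N) (hr : 0 ≤ r) (hε : 0 < ε)
    (hΞ : IsCompact (polyhedron C d)) (u : EuclideanSpace ℝ (Fin (m + 1))) :
    u ∈ (D.robustProblem x (polyhedron C d) ξ r ε).feasible ↔
      ∃ w, (u, w) ∈ (D.quadraticProblem x C d ξ r ε).feasible := by
  have hG : ∀ l, (fun ζ : polyhedron C d => D.G l x u ζ) = fun ζ =>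
      (u.ofLp ᵥ* D.R l x) ⬝ᵥ ζ.1.ofLp + (u.ofLp ⬝ᵥ D.q l x + D.α l (D.J l x)) := fun l => by
    ext ζ
    rw [SynthesisData.G, dotProduct_mulVec]
    ring
  have key : u ∈ (D.robustProblem x (polyhedron C d) ξ r ε).feasible ↔
      u ∈ inputSet m ∧ ∀ l, ∃ t s β η, IsDualFeasible (u.ofLp ᵥ* D.R l x)
        (u.ofLp ⬝ᵥ D.q l x + D.α l (D.J l x)) C d (fun i => (ξ i).1.ofLp) r ε t s β η := by
    refine and_congr_right fun _ => forall_congr' fun l => ?_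
    rw [hG, iSup_CVaR_nonpos_iff hN hr hε hΞ]
  rw [key]
  constructor
  · rintro ⟨hu, h⟩
    choose t s β η h using h
    exact ⟨(t, s, β, η), (mem_feasible_quadraticProblem_iff ..).2 ⟨hu, h⟩⟩
  · rintro ⟨⟨t, s, β, η⟩, h⟩
    have h := (mem_feasible_quadraticProblem_iff ..).1 h
    exact ⟨h.1, fun l => ⟨_, _, _, _, h.2 l⟩⟩

end Program

theorem proposition4 {n m k q M N : ℕ} (hq : 0 < q) (hN : 0 < N)
    (D : DRControl.SynthesisData n m k M) (x : D.stateSet)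
    (C : Matrix (Fin q) (Fin k) ℝ) (d : Fin q → ℝ)
    (hΞ : IsCompact (DRControl.polyhedron C d))
    (ξ : Fin N → DRControl.polyhedron C d)
    (r ε : ℝ) (hr : 0 ≤ r) (hε : ε ∈ Set.Ioo (0 : ℝ) 1) :
    (D.quadraticProblem x C d ξ r ε).IsQP ∧
    (D.robustProblem x (DRControl.polyhedron C d) ξ r ε).EquivalentLift
      (D.quadraticProblem x C d ξ r ε) := by
  refine ⟨⟨inferInstance, isPolyhedral_feasible_quadraticProblem D x C d ξ r ε,
    exists_quadratic_eq_norm_sub_sq (D.baseline x)⟩, ?_⟩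
  exact OptProblem.equivalentLift_of_feasible (fun _ _ => rfl)
    (mem_feasible_robustProblem_iff D x C d ξ r ε hN hr hε.1 hΞ)
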